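/- **Setting.** Let $N\ge 2$, $\mathcal N=\{1,\dots,N\}$, and let $G$ be a connected undirected graph (without loops or multiple edges) with vertex set $\mathcal N$. Let $\mathcal N_i$ be the set of neighbours of $i$, $d_i=|\mathcal N_i|$, let $\tilde d\in\mathbb N$ satisfy $d_i\le\tilde d$ for all $i$, and let $L$ be the graph Laplacian, with second smallest eigenvalue $\lambda_2(L)$. Fix $0<\gamma\le\lambda_2(L)$ and put $$\Gamma_\infty=\sup_{t\ge0}\Big\|e^{\gamma t}\big(e^{-Lt}-\tfrac1N\mathbf 1\mathbf 1^\top\big)\Big\|_\infty ,$$ where $\|\cdot\|_\infty$ is the matrix norm induced by the maximum norm. For $y\ge 0$, $W(y)$ denotes the solution $x\ge0$ of $xe^x=y$. **Quantizer.** Let $R=2R_0+1$ with $R_0\in\mathbb N_0$. For $E>0$ and $z\in[-E,E]$ let $Q_{E,R}[z]=0$ if $|z|\le E/R$, $Q_{E,R}[z]=2pE/R$ if $(2p-1)E/R<z\le(2p+1)E/R$ with $p\in\{1,\dots,R_0\}$, and $Q_{E,R}[z]=-Q_{E,R}[-z]$ if $z<-E/R$. For $|z|>E$ (saturation) the output $Q_{E,R}[z]\in\mathbb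 R$ is arbitrary. **System.** Let $\delta_i>0$, $\tau^i_{\max}>0$, $\tau^i_{\min}>0$ $(i\in\mathcal N)$ and $\omega>0$. For $E_0>0$ put $E(t)=2\Gamma_\infty E_0e^{-\omega t}$. With initial states $x_{i0}\in\mathbb R$, agent $i$ obeys, in the integrated sense, $$\dot x_i(t)=u_i(t),\quad x_i(0)=x_{i0},\qquad u_i(t)=-\sum_{j\in\mathcal N_i}Q_{E(t^i_k),R}\big[x_i(t^i_k)-x_j(t^i_k)\big]\quad (t^i_k\le t<t^i_{k+1}),$$ where the sampling times are given by $t^i_0=0$ and $$t^i_{k+1}=t^i_k+\min\{\tau^i_k,\tau^i_{\max}\},\qquad \tau^i_k=\inf\Big\{\tau\ge\tau^i_{\min}:\Big|\sum_{j\in\mathcal N_i}\int_{t^i_k}^{t^i_k+\tau}\big(u_i(s)-u_j(s)\big)\,ds\Big|\ge\delta_iE(t^i_k+\tau)\Big\}$$ (with $\inf\emptyset=\infty$). **Theorem.** Assume that, for all $i\in\mathcal N$, 1. $\displaystyle \delta_i+\frac{d_i}{R}<\frac{\gamma}{2\Gamma_\infty}$; 2. $0<\tau^i_{\min}\le\min\{\tilde\tau^i_{\min},\tau^i_{\max}\}$,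 where $\displaystyle\tilde\tau^i_{\min}=\frac1\omega W\!\left(\frac{\omega\delta_i}{d_i^2+\sum_{j\in\mathcal N_i}d_je^{\omega\tau^j_{\max}}}\right)$; 3. $0<\omega\le\tilde\omega$, where $\displaystyle\tilde\omega=\min_{i\in\mathcal N}\left\{\eta_i-\frac{W\big(\xi_i\tau^i_{\max}e^{\eta_i\tau^i_{\max}}\big)}{\tau^i_{\max}}\right\}$, $\displaystyle\xi_i=\frac{2\Gamma_\infty d_i}{R}$, $\eta_i=\gamma-2\Gamma_\infty\delta_i$. Then for every $E_0>0$, for all initial states with $\big|x_{i0}-\frac1N\sum_{j\in\mathcal N}x_{j0}\big|\le E_0$ for all $i\in\mathcal N$, and for every trajectory of the system: - the quantizers are never saturated: $|x_i(t^i_k)-x_j(t^i_k)|\le E(t^i_k)$ for all $i\in\mathcal N$, $j\in\mathcal N_i$, $k\in\mathbb N_0$; - $|x_i(t)-x_j(t)|\le2\Gamma_\infty E_0e^{-\omega t}$ for all $t\ge0$ and $i,j\in\mathcal N$. In particular, the system achieves consensus exponentially with decay rate $\omega$: there is a constant $\Omega>0$, independent of $E_0$ and of the initial states, such that $|x_i(t)-x_j(t)|\le\Omega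 E_0e^{-\omega t}$ for all $t\ge0$, $i,j\in\mathcal N$ and every such trajectory. -/

import Mathlib

namespace QuantizedConsensus

noncomputable section

/-! Lambert W function on the nonnegative reals. -/

theorem exists_mul_exp_eq {y : ℝ} (hy : 0 ≤ y) : ∃ x : ℝ, 0 ≤ x ∧ x * Real.exp x = y := by
  have hc : ContinuousOn (fun x : ℝ => x * Real.exp x) (Set.Icc 0 y) := by fun_prop
  have h1 : y ≤ y * Real.exp y := le_mul_of_one_le_right hy (Real.one_le_exp hy)
  have hmem : y ∈ Set.Icc ((fun x : ℝ => x * Real.exp x) 0) ((fun x : ℝ => x * Real.exp x) y) := by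
    simp [hy, h1]
  obtain ⟨x, hx, hxy⟩ := intermediate_value_Icc hy hc hmem
  exact ⟨x, hx.1, hxy⟩

open Classical in
/-- `W(y)` for `y ≥ 0`: the (unique) solution `x ≥ 0` of `x * exp x = y`. For `y < 0` it is `0` by
convention; such arguments are not used. -/
def lambertW (y : ℝ) : ℝ :=
  if hy : 0 ≤ y then (exists_mul_exp_eq hy).choose else 0

theorem lambertW_nonneg {y : ℝ} (hy : 0 ≤ y) : 0 ≤ lambertW y := by
  rw [lambertW, dif_pos hy]
  exact (exists_mul_exp_eq hy).choose_spec.1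

theorem lambertW_mul_exp {y : ℝ} (hy : 0 ≤ y) : lambertW y * Real.exp (lambertW y) = y := by
  rw [lambertW, dif_pos hy]
  exact (exists_mul_exp_eq hy).choose_spec.2

/-! Graph constants. -/

variable {N : ℕ}

/-- The second smallest eigenvalue, counted with multiplicity, of a symmetric matrix of size `N ≥ 2`.
(`eigenvalues₀` lists the eigenvalues in decreasing order, so the second smallest one has
index `N - 2`.) -/
def lambdaTwo (hN : 2 ≤ N) (P : Matrix (Fin N) (Fin N) ℝ) (hP : P.IsHermitian) : ℝ :=
  hP.eigenvalues₀ ⟨N - 2, by rw [Fintype.card_fin]; omega⟩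

/-- The second smallest eigenvalue of the graph Laplacian of `G`. -/
def algebraicConnectivity (hN : 2 ≤ N) (G : SimpleGraph (Fin N)) [DecidableRel G.Adj] : ℝ :=
  lambdaTwo hN (G.lapMatrix ℝ) (SimpleGraph.posSemidef_lapMatrix ℝ G).isHermitian

/-- The matrix norm induced by the maximum norm, i.e. the maximal absolute row sum. -/
def matrixInfNorm (A : Matrix (Fin N) (Fin N) ℝ) : ℝ :=
  (Matrix.linftyOpNormedAddCommGroup : NormedAddCommGroup (Matrix (Fin N) (Fin N) ℝ)).norm A

/-- The averaging matrix, all of whose entries are `1 / N`. -/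
def averageMatrix (N : ℕ) : Matrix (Fin N) (Fin N) ℝ :=
  Matrix.of fun _ _ => 1 / (N : ℝ)

/-- `Γ_∞(γ) = sup_{t ≥ 0} ‖exp (γ t) (exp (- L t) - averageMatrix)‖_∞`, with `L` the Laplacian. -/
def gammaInf (G : SimpleGraph (Fin N)) [DecidableRel G.Adj] (γ : ℝ) : ℝ :=
  sSup ((fun t : ℝ => matrixInfNorm
    (Real.exp (γ * t) • (NormedSpace.exp (-(t • G.lapMatrix ℝ)) - averageMatrix N))) '' Set.Ici 0)

/-! The finite-level quantizer. -/

/-- The uniform quantizer with range `E` and `R` levels at a point `z` of `[-E, E]`.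
For `E, R > 0` and `z > E / R`, the integer `p = ⌈(R z / E - 1) / 2⌉` is the one
with `(2 p - 1) E / R < z ≤ (2 p + 1) E / R`. -/
def uniformQuantizer (E : ℝ) (R : ℕ) (z : ℝ) : ℝ :=
  if |z| ≤ E / R then 0
  else if E / R < z then 2 * (⌈(R * z / E - 1) / 2⌉ : ℝ) * E / R
  else -(2 * (⌈(R * (-z) / E - 1) / 2⌉ : ℝ) * E / R)

/-- The quantizer on the whole line: the uniform quantizer on `[-E, E]`, and an arbitrary output
`overflow E z` if it is saturated, i.e. if `z` is outside `[-E, E]`. -/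
def quantizer (overflow : ℝ → ℝ → ℝ) (E : ℝ) (R : ℕ) (z : ℝ) : ℝ :=
  if |z| ≤ E then uniformQuantizer E R z else overflow E z

/-- The quantization range `E(t) = 2 Γ_∞ E₀ exp (- ω t)`. -/
def quantRange (G : SimpleGraph (Fin N)) [DecidableRel G.Adj] (γ E₀ ω t : ℝ) : ℝ :=
  2 * gammaInf G γ * E₀ * Real.exp (-(ω * t))

/-- `q_i(s) = ∑_{j ∈ N_i} Q_{E(s),R}[x_i(s) - x_j(s)]`. -/
def quantizedSum (G : SimpleGraph (Fin N)) [DecidableRel G.Adj] (R : ℕ) (overflow : ℝ → ℝ → ℝ)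
    (E : ℝ → ℝ) (x : Fin N → ℝ → ℝ) (i : Fin N) (s : ℝ) : ℝ :=
  ∑ j ∈ G.neighborFinset i, quantizer overflow (E s) R (x i s - x j s)

/-! The closed loop. -/

/-- The error due to sampling, `τ` time units after the time `a`:
`∑_{j ∈ N_i} ∫_a^{a+τ} (u_i(s) - u_j(s)) ds`. -/
def samplingError (G : SimpleGraph (Fin N)) [DecidableRel G.Adj] (u : Fin N → ℝ → ℝ)
    (i : Fin N) (a τ : ℝ) : ℝ :=
  ∑ j ∈ G.neighborFinset i, ∫ s in a..(a + τ), (u i s - u j s)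

/-- `inf {τ ≥ τmin_i : |f(τ)| ≥ δ_i E(a + τ)}`, with `f` the error due to sampling since the
sampling time `a` of agent `i`; the infimum is `∞` if there is no such `τ`. -/
def triggerDelay (G : SimpleGraph (Fin N)) [DecidableRel G.Adj] (E : ℝ → ℝ)
    (δ τmin : Fin N → ℝ) (u : Fin N → ℝ → ℝ) (i : Fin N) (a : ℝ) : EReal :=
  ⨅ τ ∈ {τ : ℝ | τmin i ≤ τ ∧ δ i * E (a + τ) ≤ |samplingError G u i a τ|}, (τ : EReal)

/-- States `x`, inputs `u` and sampling times `t` (where `t i k` is the `k`-th sampling time of agent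
`i`) form a trajectory of the quantized self-triggered multi-agent system with quantization range
`E` and initial state `x₀`. -/
structure IsTrajectory (G : SimpleGraph (Fin N)) [DecidableRel G.Adj] (R : ℕ)
    (overflow : ℝ → ℝ → ℝ) (E : ℝ → ℝ) (δ τmin τmax : Fin N → ℝ) (x₀ : Fin N → ℝ)
    (x u : Fin N → ℝ → ℝ) (t : Fin N → ℕ → ℝ) : Prop where
  /-- `x_i' = u_i` and `x_i(0) = x₀_i`, in integrated form (the inputs are piecewise constant) -/
  dynamics : ∀ i, ∀ s, 0 ≤ s → x i s = x₀ i + ∫ r in (0 : ℝ)..s, u i r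
  /-- the input is held between sampling times -/
  input : ∀ i k s, t i k ≤ s → s < t i (k + 1) → u i s = -quantizedSum G R overflow E x i (t i k)
  /-- the first sampling time is `0` -/
  first_sampling : ∀ i, t i 0 = 0
  /-- the triggering rule -/
  next_sampling : ∀ i k, ((t i (k + 1) - t i k : ℝ) : EReal) =
    min (triggerDelay G E δ τmin u i (t i k)) (τmax i : EReal)

/-- At every sampling time of an agent, its quantizer is not saturated. -/
def Unsaturated (G : SimpleGraph (Fin N)) (E : ℝ → ℝ) (x : Fin N → ℝ → ℝ)
    (t : Fin N → ℕ → ℝ) : Prop :=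
  ∀ i k, ∀ j, G.Adj i j → |x i (t i k) - x j (t i k)| ≤ E (t i k)

/-- `E₀` bounds the deviations of the initial states from their average. -/
def InitialBound (x₀ : Fin N → ℝ) (E₀ : ℝ) : Prop :=
  ∀ i, |x₀ i - (1 / (N : ℝ)) * ∑ j, x₀ j| ≤ E₀

/-- The multi-agent system achieves consensus exponentially with decay rate `ω`, the constant `Ω`
being independent of `E₀` (and of the initial state). -/
def AchievesConsensus (G : SimpleGraph (Fin N)) [DecidableRel G.Adj] (R : ℕ)
    (overflow : ℝ → ℝ → ℝ) (γ ω : ℝ) (δ τmin τmax : Fin N → ℝ) : Prop :=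
  ∃ Ω : ℝ, 0 < Ω ∧ ∀ (E₀ : ℝ), 0 < E₀ → ∀ x₀ : Fin N → ℝ, InitialBound x₀ E₀ →
    ∀ (x u : Fin N → ℝ → ℝ) (t : Fin N → ℕ → ℝ),
      IsTrajectory G R overflow (quantRange G γ E₀ ω) δ τmin τmax x₀ x u t →
        ∀ s, 0 ≤ s → ∀ i j, |x i s - x j s| ≤ Ω * E₀ * Real.exp (-(ω * s))

/-! The thresholds in the parameter conditions. -/

/-- `(1 / ω) W(ω δ_i / (d_i ^ 2 + ∑_{j ∈ N_i} d_j exp (ω τmax_j)))`. -/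
def tauTildeMin (G : SimpleGraph (Fin N)) [DecidableRel G.Adj] (ω : ℝ) (δ τmax : Fin N → ℝ)
    (i : Fin N) : ℝ :=
  (1 / ω) * lambertW (ω * δ i /
    ((G.degree i : ℝ) ^ 2 + ∑ j ∈ G.neighborFinset i, (G.degree j : ℝ) * Real.exp (ω * τmax j)))

/-- `ξ_i = 2 Γ_∞ d_i / R`. -/
def xiParam (G : SimpleGraph (Fin N)) [DecidableRel G.Adj] (γ : ℝ) (R : ℕ) (i : Fin N) : ℝ :=
  2 * gammaInf G γ * (G.degree i : ℝ) / R

/-- `η_i = γ - 2 Γ_∞ δ_i`. -/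
def etaParam (G : SimpleGraph (Fin N)) [DecidableRel G.Adj] (γ : ℝ) (δ : Fin N → ℝ)
    (i : Fin N) : ℝ :=
  γ - 2 * gammaInf G γ * δ i

/-- The largest admissible decay rate,
`min_i (η_i - W(ξ_i τmax_i exp (η_i τmax_i)) / τmax_i)`. -/
def omegaTilde (G : SimpleGraph (Fin N)) [DecidableRel G.Adj] (γ : ℝ) (R : ℕ)
    (δ τmax : Fin N → ℝ) : ℝ :=
  ⨅ i : Fin N, (etaParam G γ δ i -
    lambertW (xiParam G γ R i * τmax i * Real.exp (etaParam G γ δ i * τmax i)) / τmax i)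

end

end QuantizedConsensus

/-! Write `J` for the averaging matrix, `D(t) = exp(-tL) - J`, and `x' = -Lx + f` with `f = u + Lx`.
The perturbation `f_i` has two parts: the quantization error held since the last sampling, at most
`d_i E / R` with `E` taken at the sampling time, and the drift of the relative states since then, at
most `δ_i E(s)`. The triggering rule bounds the drift after `τmin_i`; before that, condition 2 does,
because the inputs are bounded. Since `E` decays by at most `exp(-ω τmax_i)` between samplings,
condition 3 is what makes `2 Γ |f_i(s)| ≤ (γ - ω) E(s)`.

Variation of constants then closes the loop. Along `s ↦ D(T - s)(x(s) - c)` the norm starts below `Γ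
E₀ exp(-γT)` and has derivative of norm at most `Γ exp(-γ(T - s)) (γ - ω) E₀ exp(-ωs)`. Integrating
gives exactly `Γ E₀ exp(-ωT)` at `s = T`, where the vector is the deviation of `x(T)` from its
average. Two deviations differ by at most `2 Γ E₀ exp(-ωT) = E(T)`.

The bound at `T` uses unsaturated quantizers only at sampling times strictly before `T`. Hence a
first saturated sampling time, which would exist because there is no Zeno behaviour, is
contradictory. The two halves are `abs_state_sub_state_le` and `unsaturated`. -/

namespace QuantizedConsensus

noncomputable section

/-! ### Inequalities for the Lambert function. -/

section LambertW

theorem mul_exp_le_of_le_lambertW {x y : ℝ} (hy : 0 ≤ y) (hx : 0 ≤ x) (h : x ≤ lambertW y) :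
    x * Real.exp x ≤ y := by
  rw [← lambertW_mul_exp hy]
  exact mul_le_mul h (Real.exp_le_exp.2 h) (Real.exp_pos _).le (hx.trans h)

theorem le_mul_exp_of_lambertW_le {x y : ℝ} (hy : 0 ≤ y) (h : lambertW y ≤ x) :
    y ≤ x * Real.exp x := by
  have h0 := lambertW_nonneg hy
  rw [← lambertW_mul_exp hy]
  exact mul_le_mul h (Real.exp_le_exp.2 h) (Real.exp_pos _).le (h0.trans h)

end LambertW

/-! ### The Laplacian semigroup off the consensus direction. -/

section Semigroup

open Matrix
open scoped Matrix.Norms.Operator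

variable {N : ℕ}

theorem matrixInfNorm_eq_norm (A : Matrix (Fin N) (Fin N) ℝ) : matrixInfNorm A = ‖A‖ := rfl

/-- The family whose supremum of norms is `gammaInf`, without the factor `exp (γ t)`. -/
def disagreementSemigroup (G : SimpleGraph (Fin N)) [DecidableRel G.Adj] (t : ℝ) :
    Matrix (Fin N) (Fin N) ℝ :=
  NormedSpace.exp (-(t • G.lapMatrix ℝ)) - averageMatrix N

variable (G : SimpleGraph (Fin N)) [DecidableRel G.Adj]

theorem averageMatrix_mulVec (v : Fin N → ℝ) (i : Fin N) :
    (averageMatrix N *ᵥ v) i = (1 / (N : ℝ)) * ∑ j, v j := by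
  simp [averageMatrix, Matrix.mulVec, dotProduct, Finset.mul_sum]

theorem lapMatrix_mul_averageMatrix : G.lapMatrix ℝ * averageMatrix N = 0 := by
  ext i j
  have h := congrFun (G.lapMatrix_mulVec_const_eq_zero (R := ℝ)) i
  simp only [Matrix.mulVec, dotProduct, mul_one, Pi.zero_apply] at h
  simp [Matrix.mul_apply, averageMatrix, ← Finset.sum_mul, h]

theorem averageMatrix_mul_lapMatrix : averageMatrix N * G.lapMatrix ℝ = 0 := by
  have h := congrArg Matrix.transpose (lapMatrix_mul_averageMatrix G)
  rwa [Matrix.transpose_mul, (SimpleGraph.isSymm_lapMatrix (R := ℝ) G).eq,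
    show (averageMatrix N)ᵀ = averageMatrix N from rfl, Matrix.transpose_zero] at h

/-- For a connected graph, every eigenvalue of the Laplacian other than `0` is at least the
algebraic connectivity. -/
theorem algebraicConnectivity_le_eigenvalues (hN : 2 ≤ N) (hpos : 0 < algebraicConnectivity hN G)
    (k : Fin N) (hk : (G.posSemidef_lapMatrix ℝ).isHermitian.eigenvalues k ≠ 0) :
    algebraicConnectivity hN G ≤ (G.posSemidef_lapMatrix ℝ).isHermitian.eigenvalues k := by
  set hP := (G.posSemidef_lapMatrix ℝ).isHermitian
  set e : Fin (Fintype.card (Fin N)) ≃ Fin N :=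
    Fintype.equivOfCardEq (Fintype.card_fin _)
  have hle : ∀ l : Fin N, (e.symm l : ℕ) ≤ N - 2 →
      algebraicConnectivity hN G ≤ hP.eigenvalues l := fun l hl =>
    hP.eigenvalues₀_antitone (Fin.mk_le_mk.2 hl)
  have : Nonempty (Fin N) := ⟨⟨0, by omega⟩⟩
  have hdet := G.det_lapMatrix_eq_zero
  rw [hP.det_eq_prod_eigenvalues, Finset.prod_eq_zero_iff] at hdet
  obtain ⟨m, -, hm⟩ := hdet
  have hm0 : hP.eigenvalues m = 0 := hm
  -- All eigenvalues of sorted index at most `N - 2` are positive, so the zero eigenvalue sits at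
  -- the last index `N - 1`, and only there.
  have hmN : ¬ (e.symm m : ℕ) ≤ N - 2 := fun h => by
    have := hle m h
    linarith
  apply hle
  by_contra hkN
  have hc := Fintype.card_fin N
  have : e.symm k = e.symm m := by
    apply Fin.ext
    have h1 := (e.symm k).isLt
    have h2 := (e.symm m).isLt
    omega
  exact hk (e.symm.injective this ▸ hm0)

/-- Connectedness makes the kernel of `L` the constant vectors, which `J` fixes; on the other
eigenvectors `J L = 0` forces `J v = 0`. Thus an eigenbasis of `L` also diagonalizes `J`. -/
theorem averageMatrix_mulVec_of_lapMatrix_mulVec_eq_smul (hG : G.Connected)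
    {v : Fin N → ℝ} {c : ℝ} (hv : G.lapMatrix ℝ *ᵥ v = c • v) :
    averageMatrix N *ᵥ v = (if c = 0 then 1 else 0 : ℝ) • v := by
  split_ifs with hc
  · rw [hc, zero_smul, SimpleGraph.lapMatrix_mulVec_eq_zero_iff_forall_reachable] at hv
    ext i
    have hN : (N : ℝ) ≠ 0 := by
      have := i.pos
      positivity
    rw [averageMatrix_mulVec, Finset.sum_congr rfl fun j _ => hv j i (hG.preconnected j i)]
    simp [hN]
  · have h := congrArg (averageMatrix N *ᵥ ·) hv
    simp only [Matrix.mulVec_mulVec, averageMatrix_mul_lapMatrix, Matrix.zero_mulVec,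
      Matrix.mulVec_smul] at h
    rw [zero_smul]
    exact (smul_eq_zero.1 h.symm).resolve_left hc

/-- Makes the `sSup` in `gammaInf` a genuine supremum. In an orthonormal eigenbasis the matrix is
diagonal, with entry `0` on the kernel and `exp((γ - l_k) t) ≤ 1` elsewhere, since `γ ≤ l_k` for
each nonzero eigenvalue; the change of basis costs a factor independent of `t`. -/
theorem bddAbove_norm_disagreementSemigroup (hN : 2 ≤ N) (hG : G.Connected) {γ : ℝ} (hγ : 0 < γ)
    (hγ' : γ ≤ algebraicConnectivity hN G) :
    BddAbove ((fun t : ℝ => matrixInfNorm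
      (Real.exp (γ * t) • disagreementSemigroup G t)) '' Set.Ici 0) := by
  set hP := (G.posSemidef_lapMatrix ℝ).isHermitian
  set U : Matrix (Fin N) (Fin N) ℝ := hP.eigenvectorUnitary.1
  set l : Fin N → ℝ := hP.eigenvalues
  have hUs : U * star U = 1 := (Matrix.mem_unitaryGroup_iff).1 hP.eigenvectorUnitary.2
  have hsU : star U * U = 1 := (Matrix.mem_unitaryGroup_iff').1 hP.eigenvectorUnitary.2
  have hcol : ∀ k, U *ᵥ Pi.single k 1 = hP.eigenvectorBasis k := hP.eigenvectorUnitary_mulVec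
  have hL : G.lapMatrix ℝ = U * diagonal l * star U := by
    conv_lhs => rw [hP.spectral_theorem]
    rfl
  have hJ : averageMatrix N * U = U * diagonal (fun k => if l k = 0 then (1 : ℝ) else 0) := by
    ext i k
    have h := congrFun (averageMatrix_mulVec_of_lapMatrix_mulVec_eq_smul G hG
      (hP.mulVec_eigenvectorBasis k)) i
    rw [← hcol, Matrix.mulVec_mulVec] at h
    simpa [Matrix.mul_diagonal, mul_comm] using h
  have hexp : ∀ t : ℝ, NormedSpace.exp (-(t • G.lapMatrix ℝ)) =
      U * diagonal (fun k => Real.exp (-(t * l k))) * star U := by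
    intro t
    have h := Matrix.exp_units_conj (⟨U, star U, hUs, hsU⟩ : (Matrix (Fin N) (Fin N) ℝ)ˣ)
      (diagonal (fun k => -(t * l k)))
    have h1 : -(t • G.lapMatrix ℝ) = U * diagonal (fun k => -(t * l k)) * star U := by
      rw [hL, ← smul_mul_assoc, ← mul_smul_comm, ← neg_mul, ← mul_neg]
      congr 2
      ext i j
      by_cases hij : i = j <;> simp [hij]
    rw [h1]
    refine h.trans ?_
    have h2 : NormedSpace.exp (fun k => -(t * l k)) = fun k => Real.exp (-(t * l k)) := by
      funext k
      rw [Pi.coe_exp, Real.exp_eq_exp_ℝ]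
    rw [Matrix.exp_diagonal, h2]
    rfl
  have hD : ∀ t : ℝ, Real.exp (γ * t) • disagreementSemigroup G t =
      U * diagonal (fun k => Real.exp (γ * t) *
        (Real.exp (-(t * l k)) - if l k = 0 then (1 : ℝ) else 0)) * star U := by
    intro t
    have h1 : averageMatrix N =
        U * diagonal (fun k => if l k = 0 then (1 : ℝ) else 0) * star U := by
      rw [← hJ, mul_assoc, hUs, mul_one]
    rw [disagreementSemigroup, hexp, h1, ← sub_mul, ← mul_sub, ← smul_mul_assoc, ← mul_smul_comm,
      Matrix.diagonal_sub, ← Matrix.diagonal_smul]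
    rfl
  refine ⟨‖U‖ * 1 * ‖star U‖, ?_⟩
  rintro _ ⟨t, ht, rfl⟩
  have ht0 : 0 ≤ t := ht
  change matrixInfNorm (Real.exp (γ * t) • disagreementSemigroup G t) ≤ _
  rw [matrixInfNorm_eq_norm, hD]
  refine (norm_mul_le _ _).trans (mul_le_mul_of_nonneg_right ?_ (norm_nonneg _))
  refine (norm_mul_le _ _).trans (mul_le_mul_of_nonneg_left ?_ (norm_nonneg _))
  rw [Matrix.linfty_opNorm_diagonal, pi_norm_le_iff_of_nonneg zero_le_one]
  intro k
  split_ifs with hk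
  · simp [hk]
  · have h := hγ'.trans (algebraicConnectivity_le_eigenvalues G hN (hγ.trans_le hγ') k hk)
    rw [sub_zero, ← Real.exp_add, Real.norm_of_nonneg (Real.exp_pos _).le, Real.exp_le_one_iff]
    have := mul_le_mul_of_nonneg_left h ht0
    linarith

theorem norm_disagreementSemigroup_le (hN : 2 ≤ N) (hG : G.Connected) {γ : ℝ} (hγ : 0 < γ)
    (hγ' : γ ≤ algebraicConnectivity hN G) {t : ℝ} (ht : 0 ≤ t) :
    ‖disagreementSemigroup G t‖ ≤ gammaInf G γ * Real.exp (-(γ * t)) := by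
  have h := le_csSup (bddAbove_norm_disagreementSemigroup G hN hG hγ hγ')
    (Set.mem_image_of_mem _ (Set.mem_Ici.2 ht))
  have h2 : Real.exp (γ * t) * ‖disagreementSemigroup G t‖ ≤ gammaInf G γ := by
    refine le_trans (le_of_eq ?_) h
    rw [matrixInfNorm_eq_norm, norm_smul, Real.norm_of_nonneg (Real.exp_pos _).le]
  rw [Real.exp_neg, ← div_eq_mul_inv, le_div_iff₀ (Real.exp_pos _), mul_comm]
  exact h2

theorem gammaInf_pos (hN : 2 ≤ N) (hG : G.Connected) {γ : ℝ} (hγ : 0 < γ)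
    (hγ' : γ ≤ algebraicConnectivity hN G) : 0 < gammaInf G γ := by
  have h := norm_disagreementSemigroup_le G hN hG hγ hγ' le_rfl
  rw [mul_zero, neg_zero, Real.exp_zero, mul_one] at h
  refine lt_of_lt_of_le (norm_pos_iff.2 fun h0 => ?_) h
  -- At time `0` the matrix is `1 - J`, whose off-diagonal entries are `-1 / N`.
  have h1 := congrFun (congrFun h0 ⟨0, by omega⟩) ⟨1, by omega⟩
  simp [disagreementSemigroup, averageMatrix] at h1
  omega

theorem disagreementSemigroup_zero_mulVec (v : Fin N → ℝ) (i : Fin N) :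
    (disagreementSemigroup G 0 *ᵥ v) i = v i - (1 / (N : ℝ)) * ∑ j, v j := by
  rw [disagreementSemigroup, zero_smul, neg_zero, NormedSpace.exp_zero, Matrix.sub_mulVec,
    Matrix.one_mulVec, Pi.sub_apply, averageMatrix_mulVec]

theorem hasDerivAt_disagreementSemigroup_apply (T s : ℝ) (i j : Fin N) :
    HasDerivAt (fun s => disagreementSemigroup G (T - s) i j)
      ((disagreementSemigroup G (T - s) * G.lapMatrix ℝ) i j) s := by
  have h1 := hasDerivAt_exp_smul_const (𝕂 := ℝ) (G.lapMatrix ℝ) (s - T)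
  have h2 : HasDerivAt (fun s => NormedSpace.exp ((s - T) • G.lapMatrix ℝ))
      (NormedSpace.exp ((s - T) • G.lapMatrix ℝ) * G.lapMatrix ℝ) s := by
    exact h1.comp_sub_const s T
  have h3 : HasDerivAt (fun s => disagreementSemigroup G (T - s))
      (disagreementSemigroup G (T - s) * G.lapMatrix ℝ) s := by
    -- `J L = 0`, so the derivative of the exponential alone is already that of the difference.
    simp only [disagreementSemigroup, sub_mul, averageMatrix_mul_lapMatrix, sub_zero, ← neg_smul,
      neg_sub]
    exact h2.sub_const _
  exact ((Matrix.entryLinearMap ℝ ℝ i j).toContinuousLinearMap.hasFDerivAt.comp_hasDerivAt s h3)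

end Semigroup

end

end QuantizedConsensus

/-! ### Quantizer error and regularity of trajectories. -/

namespace QuantizedConsensus

noncomputable section

open MeasureTheory Set

section Quantizer

theorem uniformQuantizer_bounds_of_lt {E z : ℝ} {R : ℕ} (hE : 0 < E) (hR : Odd R)
    (hz : E / R < z) (hzE : z ≤ E) :
    |2 * (⌈(R * z / E - 1) / 2⌉ : ℝ) * E / R - z| ≤ E / R ∧
      |2 * (⌈(R * z / E - 1) / 2⌉ : ℝ) * E / R| ≤ E := by
  have hR0 : (0 : ℝ) < R := by exact_mod_cast hR.pos
  obtain ⟨m, hm⟩ := hR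
  have hRm : (R : ℝ) = 2 * m + 1 := by rw [hm]; push_cast; ring
  set p := ⌈(R * z / E - 1) / 2⌉
  have hp1 : (R * z / E - 1) / 2 ≤ (p : ℝ) := Int.le_ceil _
  have hp2 : (p : ℝ) < (R * z / E - 1) / 2 + 1 := Int.ceil_lt_add_one _
  -- Oddness of `R` enters here: the top level `2 m E / R = E - E / R` stays within the range.
  have hpm : (p : ℝ) ≤ m := by
    have : p ≤ (m : ℤ) := by
      rw [Int.ceil_le]
      have : R * z / E ≤ R := by
        rw [div_le_iff₀ hE]
        exact mul_le_mul_of_nonneg_left hzE hR0.le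
      push_cast
      linarith
    exact_mod_cast this
  have hER : 0 < E / R := div_pos hE hR0
  have hz1 : (R * z / E) * (E / R) = z := by field_simp
  have e1 : 2 * (p : ℝ) * E / R = 2 * p * (E / R) := by ring
  have h1 := mul_le_mul_of_nonneg_right hp1 hER.le
  have h2 := mul_le_mul_of_nonneg_right hp2.le hER.le
  have h3 := mul_le_mul_of_nonneg_right hpm hER.le
  have h4 : (2 * m + 1) * (E / R) = E := by rw [← hRm]; field_simp
  rw [e1, abs_le, abs_le]
  constructor <;> constructor <;> linarith

/-- The quantization error of an unsaturated quantizer is at most `E / R`, and its output is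
at most `E`. -/
theorem quantizer_bounds (overflow : ℝ → ℝ → ℝ) {E z : ℝ} {R : ℕ} (hE : 0 < E) (hR : Odd R)
    (hz : |z| ≤ E) :
    |quantizer overflow E R z - z| ≤ E / R ∧ |quantizer overflow E R z| ≤ E := by
  have hz' := abs_le.1 hz
  rw [quantizer, if_pos hz, uniformQuantizer]
  split_ifs with h1 h2
  · exact ⟨by simpa using h1, by simpa using hE.le⟩
  · exact uniformQuantizer_bounds_of_lt hE hR h2 hz'.2
  · have h3 : E / R < -z := by
      rcases lt_abs.1 (not_le.1 h1) with h | h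
      · exact absurd h h2
      · exact h
    have h := uniformQuantizer_bounds_of_lt hE hR h3 (by linarith)
    refine ⟨?_, by rw [abs_neg]; exact h.2⟩
    rw [← abs_neg]
    convert h.1 using 2
    ring

end Quantizer

section Trajectory

open Matrix

variable {N : ℕ} {G : SimpleGraph (Fin N)} [DecidableRel G.Adj] {R : ℕ}
  {overflow : ℝ → ℝ → ℝ} {E : ℝ → ℝ} {δ τmin τmax : Fin N → ℝ} {x₀ : Fin N → ℝ}
  {x u : Fin N → ℝ → ℝ} {t : Fin N → ℕ → ℝ}

theorem lapMatrix_mulVec_eq_sum_sub (v : Fin N → ℝ) (i : Fin N) :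
    (G.lapMatrix ℝ *ᵥ v) i = ∑ j ∈ G.neighborFinset i, (v i - v j) := by
  simp [SimpleGraph.lapMatrix_mulVec_apply]

namespace IsTrajectory

variable (h : IsTrajectory G R overflow E δ τmin τmax x₀ x u t)
include h

theorem sampling_step_le (i : Fin N) (k : ℕ) : t i (k + 1) ≤ t i k + τmax i := by
  have h1 : ((t i (k + 1) - t i k : ℝ) : EReal) ≤ (τmax i : EReal) :=
    (h.next_sampling i k).trans_le (min_le_right _ _)
  rw [EReal.coe_le_coe_iff] at h1
  linarith

theorem le_sampling_step (hle : ∀ i, τmin i ≤ τmax i) (i : Fin N) (k : ℕ) :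
    t i k + τmin i ≤ t i (k + 1) := by
  have h1 : (τmin i : EReal) ≤ ((t i (k + 1) - t i k : ℝ) : EReal) := by
    rw [h.next_sampling i k]
    refine le_min (le_iInf₂ fun τ hτ => ?_) ?_
    · exact EReal.coe_le_coe_iff.2 hτ.1
    · exact EReal.coe_le_coe_iff.2 (hle i)
  rw [EReal.coe_le_coe_iff] at h1
  linarith

theorem mul_le_sampling (hle : ∀ i, τmin i ≤ τmax i) (i : Fin N) (k : ℕ) :
    k * τmin i ≤ t i k := by
  induction k with
  | zero => simp [h.first_sampling]
  | succ k ih =>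
    have := h.le_sampling_step hle i k
    push_cast
    linarith

theorem sampling_nonneg (hpos : ∀ i, 0 < τmin i) (hle : ∀ i, τmin i ≤ τmax i) (i : Fin N)
    (k : ℕ) : 0 ≤ t i k :=
  le_trans (mul_nonneg k.cast_nonneg (hpos i).le) (h.mul_le_sampling hle i k)

/-- There is no Zeno behaviour. -/
theorem finite_setOf_sampling_le (hpos : ∀ i, 0 < τmin i) (hle : ∀ i, τmin i ≤ τmax i)
    (T : ℝ) : {p : Fin N × ℕ | t p.1 p.2 ≤ T}.Finite := by
  have : {p : Fin N × ℕ | t p.1 p.2 ≤ T} ⊆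
      ⋃ i : Fin N, (fun k : ℕ => (i, k)) '' Iic ⌊T / τmin i⌋₊ := by
    rintro ⟨i, k⟩ hp
    refine mem_iUnion.2 ⟨i, k, ?_, rfl⟩
    refine mem_Iic.2 (Nat.le_floor ?_)
    rw [le_div_iff₀ (hpos i)]
    exact (h.mul_le_sampling hle i k).trans hp
  exact (finite_iUnion fun i => (finite_Iic _).image _).subset this

theorem exists_sampling_interval (hpos : ∀ i, 0 < τmin i) (hle : ∀ i, τmin i ≤ τmax i)
    (i : Fin N) {s : ℝ} (hs : 0 ≤ s) : ∃ k, t i k ≤ s ∧ s < t i (k + 1) := by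
  obtain ⟨n, hn⟩ := exists_nat_gt (s / τmin i)
  have hex : ∃ n, s < t i n :=
    ⟨n, ((div_lt_iff₀ (hpos i)).1 hn).trans_le (h.mul_le_sampling hle i n)⟩
  classical
  have h0 : Nat.find hex ≠ 0 := fun h0 => by
    have := Nat.find_spec hex
    rw [h0, h.first_sampling] at this
    linarith
  refine ⟨Nat.find hex - 1, ?_, ?_⟩
  · exact not_lt.1 (Nat.find_min hex (by omega))
  · rw [Nat.sub_add_cancel (Nat.one_le_iff_ne_zero.2 h0)]
    exact Nat.find_spec hex

theorem intervalIntegrable_input (hpos : ∀ i, 0 < τmin i) (hle : ∀ i, τmin i ≤ τmax i)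
    (i : Fin N) {a b : ℝ} (ha : 0 ≤ a) (hb : 0 ≤ b) : IntervalIntegrable (u i) volume a b := by
  have key : ∀ n, IntervalIntegrable (u i) volume 0 (t i n) := by
    intro n
    rw [← h.first_sampling i]
    refine IntervalIntegrable.trans_iterate fun k _ => ?_
    have hk : t i k ≤ t i (k + 1) := by
      have := h.le_sampling_step hle i k
      linarith [hpos i]
    have hc : IntervalIntegrable (fun _ : ℝ => -quantizedSum G R overflow E x i (t i k)) volume
        (t i k) (t i (k + 1)) := intervalIntegrable_const
    rw [intervalIntegrable_iff_integrableOn_Ico_of_le hk] at hc ⊢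
    exact hc.congr_fun (fun s hs => (h.input i k s hs.1 hs.2).symm) measurableSet_Ico
  have key' : ∀ s, 0 ≤ s → IntervalIntegrable (u i) volume 0 s := by
    intro s hs
    obtain ⟨k, -, hk⟩ := h.exists_sampling_interval hpos hle i hs
    refine (key (k + 1)).mono_set ?_
    rw [uIcc_of_le hs, uIcc_of_le (hs.trans hk.le)]
    exact Icc_subset_Icc_right hk.le
  exact (key' a ha).symm.trans (key' b hb)

theorem state_sub_state (hpos : ∀ i, 0 < τmin i) (hle : ∀ i, τmin i ≤ τmax i)
    (i : Fin N) {a b : ℝ} (ha : 0 ≤ a) (hb : 0 ≤ b) :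
    x i b - x i a = ∫ s in a..b, u i s := by
  rw [h.dynamics i a ha, h.dynamics i b hb, add_sub_add_left_eq_sub,
    intervalIntegral.integral_interval_sub_left
      (h.intervalIntegrable_input hpos hle i le_rfl hb)
      (h.intervalIntegrable_input hpos hle i le_rfl ha)]

theorem continuousOn_state (hpos : ∀ i, 0 < τmin i) (hle : ∀ i, τmin i ≤ τmax i)
    (i : Fin N) {T : ℝ} (hT : 0 ≤ T) : ContinuousOn (x i) (Icc 0 T) := by
  have h1 := h.intervalIntegrable_input hpos hle i le_rfl hT
  have h2 : ContinuousOn (fun s => x₀ i + ∫ r in (0 : ℝ)..s, u i r) (Icc 0 T) := by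
    rw [← uIcc_of_le hT]
    refine continuousOn_const.add (intervalIntegral.continuousOn_primitive_interval ?_)
    rw [uIcc_of_le hT]
    exact (intervalIntegrable_iff_integrableOn_Icc_of_le hT).1 h1
  exact h2.congr fun s hs => h.dynamics i s hs.1

/-- The input is constant just to the right of `s`, so the state is affine there. A right derivative
at every point, jumps of the input included, is what the final comparison argument needs. -/
theorem hasDerivWithinAt_state (hpos : ∀ i, 0 < τmin i) (hle : ∀ i, τmin i ≤ τmax i)
    (i : Fin N) {s : ℝ} (hs : 0 ≤ s) : HasDerivWithinAt (x i) (u i s) (Ici s) s := by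
  obtain ⟨k, hk1, hk2⟩ := h.exists_sampling_interval hpos hle i hs
  have h1 : HasDerivWithinAt (fun r => x i s + (r - s) * u i s) (u i s) (Ici s) s := by
    simpa using ((((hasDerivAt_id s).sub_const s).mul_const (u i s)).const_add
      (x i s)).hasDerivWithinAt
  refine h1.congr_of_eventuallyEq ?_ (by simp)
  filter_upwards [Ico_mem_nhdsGE hk2] with r hr
  have h2 := h.state_sub_state hpos hle i hs (hs.trans hr.1)
  have h3 : ∫ q in s..r, u i q = ∫ q in s..r, u i s := by
    refine intervalIntegral.integral_congr fun q hq => ?_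
    rw [uIcc_of_le hr.1] at hq
    rw [h.input i k q (hk1.trans hq.1) (hq.2.trans_lt hr.2), h.input i k s hk1 hk2]
  rw [h3, intervalIntegral.integral_const, smul_eq_mul] at h2
  linarith

theorem samplingError_eq (hpos : ∀ i, 0 < τmin i) (hle : ∀ i, τmin i ≤ τmax i)
    (i : Fin N) {a τ : ℝ} (ha : 0 ≤ a) (hτ : 0 ≤ τ) :
    samplingError G u i a τ =
      ∑ j ∈ G.neighborFinset i, ((x i (a + τ) - x j (a + τ)) - (x i a - x j a)) := by
  refine Finset.sum_congr rfl fun j _ => ?_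
  have hb : 0 ≤ a + τ := add_nonneg ha hτ
  rw [intervalIntegral.integral_sub (h.intervalIntegrable_input hpos hle i ha hb)
    (h.intervalIntegrable_input hpos hle j ha hb), ← h.state_sub_state hpos hle i ha hb,
    ← h.state_sub_state hpos hle j ha hb]
  ring

/-- After the minimal inter-sampling time, the error due to sampling stays below the threshold
until the next sampling time. -/
theorem abs_samplingError_lt (i : Fin N) (k : ℕ) {τ : ℝ} (hτ : τmin i ≤ τ)
    (hτ' : t i k + τ < t i (k + 1)) :
    |samplingError G u i (t i k) τ| < δ i * E (t i k + τ) := by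
  by_contra hcon
  have h1 : triggerDelay G E δ τmin u i (t i k) ≤ (τ : EReal) :=
    iInf₂_le τ ⟨hτ, not_lt.1 hcon⟩
  have h2 : ((t i (k + 1) - t i k : ℝ) : EReal) ≤ (τ : EReal) :=
    ((h.next_sampling i k).trans_le (min_le_left _ _)).trans h1
  rw [EReal.coe_le_coe_iff] at h2
  linarith

end IsTrajectory

end Trajectory

end

end QuantizedConsensus

/-! ### From the parameter conditions to a bound on the perturbation `u + Lx`. -/

namespace QuantizedConsensus

noncomputable section

open MeasureTheory Set Matrix

variable {N : ℕ} {G : SimpleGraph (Fin N)} [DecidableRel G.Adj]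

section Parameters

theorem quantRange_pos {γ E₀ : ℝ} (hΓ : 0 < gammaInf G γ) (hE₀ : 0 < E₀) (ω s : ℝ) :
    0 < quantRange G γ E₀ ω s := by
  unfold quantRange
  positivity

theorem quantRange_eq_mul_exp (γ E₀ ω a b : ℝ) :
    quantRange G γ E₀ ω b = quantRange G γ E₀ ω a * Real.exp (-(ω * (b - a))) := by
  unfold quantRange
  rw [mul_assoc _ (Real.exp _) (Real.exp _), ← Real.exp_add]
  ring_nf

/-- Condition 2 with the Lambert function removed: `ωτ ≤ W(ωδ_i / D)` means `ωτ exp(ωτ) ≤ ωδ_i / D`.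
-/
theorem mul_exp_mul_le_of_le_tauTildeMin {ω : ℝ} (hω : 0 < ω) {δ τmax : Fin N → ℝ} {i : Fin N}
    (hδ : 0 < δ i) {τ : ℝ} (hτ : 0 ≤ τ) (hle : τ ≤ tauTildeMin G ω δ τmax i) :
    ((G.degree i : ℝ) ^ 2 + ∑ j ∈ G.neighborFinset i, (G.degree j : ℝ) * Real.exp (ω * τmax j)) *
      (τ * Real.exp (ω * τ)) ≤ δ i := by
  rw [tauTildeMin] at hle
  set D := (G.degree i : ℝ) ^ 2 +
    ∑ j ∈ G.neighborFinset i, (G.degree j : ℝ) * Real.exp (ω * τmax j)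
  have hD : 0 ≤ D := by positivity
  rcases hD.eq_or_lt with hD0 | hD0
  · rw [← hD0, zero_mul]
    exact hδ.le
  have h1 : ω * τ ≤ lambertW (ω * δ i / D) := by
    rw [one_div, inv_mul_eq_div, le_div_iff₀ hω] at hle
    linarith
  have h2 := mul_exp_le_of_le_lambertW (by positivity) (by positivity) h1
  rw [le_div_iff₀ hD0] at h2
  refine le_of_mul_le_mul_left ?_ hω
  linarith

/-- Condition 3 with the Lambert function removed. It gives `ξτ exp(ητ) ≤ (η - ω)τ exp((η - ω)τ)`
with `τ = τmax_i`; cancelling `τ exp((η - ω)τ)` leaves `ξ exp(ωτ) ≤ η - ω`. -/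
theorem two_mul_gammaInf_mul_le {γ ω : ℝ} (hΓ : 0 < gammaInf G γ) {R : ℕ} {δ τmax : Fin N → ℝ}
    (hτmax : ∀ i, 0 < τmax i) (hω : ω ≤ omegaTilde G γ R δ τmax) (i : Fin N) :
    2 * gammaInf G γ * (δ i + (G.degree i : ℝ) / R * Real.exp (ω * τmax i)) ≤ γ - ω := by
  have h1 : ω ≤ etaParam G γ δ i -
      lambertW (xiParam G γ R i * τmax i * Real.exp (etaParam G γ δ i * τmax i)) / τmax i :=
    hω.trans (ciInf_le (finite_range _).bddBelow i)
  have hτ := hτmax i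
  have hξ : 0 ≤ xiParam G γ R i := by
    unfold xiParam
    positivity
  have hη : etaParam G γ δ i = γ - 2 * gammaInf G γ * δ i := rfl
  set η := etaParam G γ δ i
  set ξ := xiParam G γ R i with hξdef
  have h2 : lambertW (ξ * τmax i * Real.exp (η * τmax i)) ≤ (η - ω) * τmax i := by
    rw [← div_le_iff₀ hτ]
    linarith
  have h3 := le_mul_exp_of_lambertW_le (by positivity) h2
  have h4 : Real.exp (η * τmax i) = Real.exp (ω * τmax i) * Real.exp ((η - ω) * τmax i) := by
    rw [← Real.exp_add]
    ring_nf
  rw [h4] at h3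
  have h5 : ξ * Real.exp (ω * τmax i) ≤ η - ω := by
    refine le_of_mul_le_mul_right ?_ (mul_pos hτ (Real.exp_pos ((η - ω) * τmax i)))
    linarith
  rw [hξdef, xiParam] at h5
  calc _ = 2 * gammaInf G γ * δ i + 2 * gammaInf G γ * G.degree i / R * Real.exp (ω * τmax i) := by
        ring
    _ ≤ γ - ω := by linarith

end Parameters

namespace IsTrajectory

variable {R : ℕ} {overflow : ℝ → ℝ → ℝ} {E : ℝ → ℝ} {δ τmin τmax : Fin N → ℝ} {x₀ : Fin N → ℝ}
  {x u : Fin N → ℝ → ℝ} {t : Fin N → ℕ → ℝ}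
  (h : IsTrajectory G R overflow E δ τmin τmax x₀ x u t)
include h

theorem abs_input_le (hE : ∀ s, 0 < E s) (hR : Odd R) {i : Fin N} {k : ℕ}
    (hsat : ∀ j, G.Adj i j → |x i (t i k) - x j (t i k)| ≤ E (t i k))
    {s : ℝ} (hs : t i k ≤ s) (hs' : s < t i (k + 1)) : |u i s| ≤ G.degree i * E (t i k) := by
  rw [h.input i k s hs hs', abs_neg, quantizedSum, ← G.card_neighborFinset_eq_degree,
    ← nsmul_eq_mul]
  exact (Finset.abs_sum_le_sum_abs _ _).trans (Finset.sum_le_card_nsmul _ _ _ fun j hj =>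
    (quantizer_bounds overflow (hE _) hR (hsat j ((G.mem_neighborFinset i j).1 hj))).2)

theorem abs_input_add_lapMatrix_le (hE : ∀ s, 0 < E s) (hR : Odd R) {i : Fin N} {k : ℕ}
    (hsat : ∀ j, G.Adj i j → |x i (t i k) - x j (t i k)| ≤ E (t i k))
    {s : ℝ} (hs : t i k ≤ s) (hs' : s < t i (k + 1)) :
    |u i s + ∑ j ∈ G.neighborFinset i, (x i (t i k) - x j (t i k))| ≤
      G.degree i * (E (t i k) / R) := by
  rw [h.input i k s hs hs', quantizedSum, ← G.card_neighborFinset_eq_degree, ← nsmul_eq_mul,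
    ← abs_neg, neg_add, neg_neg, ← sub_eq_add_neg, ← Finset.sum_sub_distrib]
  exact (Finset.abs_sum_le_sum_abs _ _).trans (Finset.sum_le_card_nsmul _ _ _ fun j hj =>
    (quantizer_bounds overflow (hE _) hR (hsat j ((G.mem_neighborFinset i j).1 hj))).1)

/-- Consecutive samplings are at most `τmax_i` apart, which limits how far `E` can have decayed
since the last one. -/
theorem range_at_sampling_le {ω : ℝ} (hω : 0 < ω) (hE : ∀ s, 0 < E s)
    (hdecay : ∀ a b, E b = E a * Real.exp (-(ω * (b - a)))) {i : Fin N} {k : ℕ} {s : ℝ}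
    (hs' : s < t i (k + 1)) :
    E (t i k) ≤ Real.exp (ω * τmax i) * E s := by
  rw [hdecay s (t i k), mul_comm]
  refine mul_le_mul_of_nonneg_right (Real.exp_le_exp.2 ?_) (hE s).le
  have h1 := h.sampling_step_le i k
  rw [← mul_neg]
  exact mul_le_mul_of_nonneg_left (by linarith) hω.le

variable {ω : ℝ} (hpos : ∀ i, 0 < τmin i) (hle : ∀ i, τmin i ≤ min (tauTildeMin G ω δ τmax i) (τmax i))
  (hω : 0 < ω) (hδ : ∀ i, 0 < δ i) (hE : ∀ s, 0 < E s) (hR : Odd R)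
  (hdecay : ∀ a b, E b = E a * Real.exp (-(ω * (b - a))))
  {T : ℝ} (hsat : ∀ i k, t i k < T → ∀ j, G.Adj i j → |x i (t i k) - x j (t i k)| ≤ E (t i k))
include hpos hle hω hδ hE hR hdecay hsat

/-- The error due to sampling stays below the threshold as long as no quantizer has been
saturated. -/
theorem abs_samplingError_le (i : Fin N) (k : ℕ) {τ : ℝ} (hτ : 0 ≤ τ)
    (hτ' : t i k + τ < t i (k + 1)) (hT : t i k + τ < T) :
    |samplingError G u i (t i k) τ| ≤ δ i * E (t i k + τ) := by
  have hle' : ∀ i, τmin i ≤ τmax i := fun i => (hle i).trans (min_le_right _ _)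
  rcases le_or_gt (τmin i) τ with hmin | hmin
  · exact (h.abs_samplingError_lt i k hmin hτ').le
  have ha := h.sampling_nonneg hpos hle' i k
  set a := t i k with hadef
  have hbound : ∀ j, ∀ s ∈ uIoc a (a + τ),
      ‖u i s - u j s‖ ≤ (G.degree i + G.degree j * Real.exp (ω * τmax j)) * E a := by
    intro j s hs
    rw [uIoc_of_le (by linarith)] at hs
    -- The neighbour's current input may date from before `a`, when the range was larger; this is
    -- the source of the factor `exp(ω τmax_j)`.
    obtain ⟨l, hl1, hl2⟩ := h.exists_sampling_interval hpos hle' j (ha.trans hs.1.le)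
    have h1 := h.abs_input_le hE hR (hsat i k (by linarith)) hs.1.le (hs.2.trans_lt hτ')
    have h2 := h.abs_input_le hE hR (hsat j l (by linarith [hs.2])) hl1 hl2
    have h3 := h.range_at_sampling_le hω hE hdecay hl2
    have h4 : E s ≤ E a := by
      rw [hdecay a s]
      refine mul_le_of_le_one_right (hE a).le (Real.exp_le_one_iff.2 ?_)
      have := mul_nonneg hω.le (sub_nonneg.2 hs.1.le)
      linarith
    have h5 : E (t j l) ≤ Real.exp (ω * τmax j) * E a :=
      h3.trans (mul_le_mul_of_nonneg_left h4 (Real.exp_pos _).le)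
    have h6 := mul_le_mul_of_nonneg_left h5 (G.degree j).cast_nonneg (α := ℝ)
    rw [Real.norm_eq_abs]
    refine (abs_sub _ _).trans ?_
    rw [add_mul, mul_assoc]
    linarith
  have hsum : |samplingError G u i a τ| ≤ ∑ j ∈ G.neighborFinset i,
      (G.degree i + G.degree j * Real.exp (ω * τmax j)) * E a * τ := by
    refine (Finset.abs_sum_le_sum_abs _ _).trans (Finset.sum_le_sum fun j _ => ?_)
    have := intervalIntegral.norm_integral_le_of_norm_le_const (hbound j)
    rwa [add_sub_cancel_left, abs_of_nonneg hτ] at this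
  refine hsum.trans ?_
  rw [← Finset.sum_mul, ← Finset.sum_mul, Finset.sum_add_distrib, Finset.sum_const,
    G.card_neighborFinset_eq_degree, nsmul_eq_mul, ← sq, hdecay a (a + τ), add_sub_cancel_left]
  have h1 := mul_exp_mul_le_of_le_tauTildeMin hω (hδ i) hτ
    (hmin.le.trans ((hle i).trans (min_le_left _ _)))
  have h2 := mul_le_mul_of_nonneg_right h1
    (mul_pos (hE a) (Real.exp_pos (-(ω * τ)))).le
  have h3 : Real.exp (ω * τ) * Real.exp (-(ω * τ)) = 1 := by
    rw [← Real.exp_add, add_neg_cancel, Real.exp_zero]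
  refine le_trans (le_of_eq ?_) (h2.trans (le_of_eq ?_))
  · linear_combination (-((G.degree i : ℝ) ^ 2 +
      ∑ j ∈ G.neighborFinset i, (G.degree j : ℝ) * Real.exp (ω * τmax j)) * E a * τ) * h3
  · ring

/-- With `t_k` the last sampling time of agent `i`, split `u(s) + Lx(s)` as `(u(s) + Lx(t_k)) +
(Lx(s) - Lx(t_k))`: quantization error plus sampling error. -/
theorem abs_input_add_lapMatrix_mulVec_le {s : ℝ} (hs : 0 ≤ s) (hsT : s < T) (i : Fin N) :
    |u i s + (G.lapMatrix ℝ *ᵥ fun j => x j s) i| ≤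
      (δ i + (G.degree i : ℝ) / R * Real.exp (ω * τmax i)) * E s := by
  have hle' : ∀ i, τmin i ≤ τmax i := fun i => (hle i).trans (min_le_right _ _)
  obtain ⟨k, hk1, hk2⟩ := h.exists_sampling_interval hpos hle' i hs
  have h1 := h.abs_input_add_lapMatrix_le hE hR (hsat i k (by linarith)) hk1 hk2
  have h2 := h.abs_samplingError_le hpos hle hω hδ hE hR hdecay hsat i k
    (τ := s - t i k) (by linarith) (by linarith) (by linarith)
  rw [h.samplingError_eq hpos hle' i (h.sampling_nonneg hpos hle' i k) (by linarith),
    add_sub_cancel, Finset.sum_sub_distrib] at h2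
  have h3 := h.range_at_sampling_le hω hE hdecay hk2
  have h4 := mul_le_mul_of_nonneg_left h3 (div_nonneg (G.degree i).cast_nonneg R.cast_nonneg)
    (α := ℝ)
  rw [lapMatrix_mulVec_eq_sum_sub]
  have h5 := abs_add_le (u i s + ∑ j ∈ G.neighborFinset i, (x i (t i k) - x j (t i k)))
    (∑ j ∈ G.neighborFinset i, (x i s - x j s) -
      ∑ j ∈ G.neighborFinset i, (x i (t i k) - x j (t i k)))
  rw [add_add_sub_cancel] at h5
  have h6 : (G.degree i : ℝ) * (E (t i k) / R) = G.degree i / R * E (t i k) := by ring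
  rw [add_mul, mul_assoc]
  linarith

end IsTrajectory

end

end QuantizedConsensus

/-! ### Variation of constants and exclusion of saturation. -/

namespace QuantizedConsensus

noncomputable section

open Set Matrix

variable {N : ℕ} {G : SimpleGraph (Fin N)} [DecidableRel G.Adj]

namespace IsTrajectory

variable {R : ℕ} {overflow : ℝ → ℝ → ℝ} {γ ω E₀ : ℝ} {δ τmin τmax : Fin N → ℝ}
  {x₀ : Fin N → ℝ} {x u : Fin N → ℝ → ℝ} {t : Fin N → ℕ → ℝ}
  (h : IsTrajectory G R overflow (quantRange G γ E₀ ω) δ τmin τmax x₀ x u t)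
  (hN : 2 ≤ N) (hG : G.Connected) (hγ : 0 < γ) (hγ' : γ ≤ algebraicConnectivity hN G)
  (hpos : ∀ i, 0 < τmin i) (hle : ∀ i, τmin i ≤ min (tauTildeMin G ω δ τmax i) (τmax i))
  (hτmax : ∀ i, 0 < τmax i) (hω : 0 < ω) (hω' : ω ≤ omegaTilde G γ R δ τmax)
  (hδ : ∀ i, 0 < δ i) (hR : Odd R) (hE₀ : 0 < E₀) (hx₀ : InitialBound x₀ E₀)
include h hN hG hγ hγ' hpos hle hτmax hω hω' hδ hR hE₀ hx₀

/-- As long as no quantizer has been saturated, the states differ by at most the quantization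
range. -/
theorem abs_state_sub_state_le {T : ℝ} (hT : 0 ≤ T)
    (hsat : ∀ i k, t i k < T → ∀ j, G.Adj i j →
      |x i (t i k) - x j (t i k)| ≤ quantRange G γ E₀ ω (t i k)) (i j : Fin N) :
    |x i T - x j T| ≤ quantRange G γ E₀ ω T := by
  have hle' : ∀ i, τmin i ≤ τmax i := fun i => (hle i).trans (min_le_right _ _)
  have hΓ := gammaInf_pos G hN hG hγ hγ'
  have hE := quantRange_pos (G := G) hΓ hE₀ ω
  set Γ := gammaInf G γ with hΓdef
  set M : ℝ → Matrix (Fin N) (Fin N) ℝ := fun s => disagreementSemigroup G (T - s)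
  -- The initial average stays a fixed reference: the average of the state may drift, but constants
  -- lie in the kernel of `L` and cancel in differences.
  set c : ℝ := (1 / (N : ℝ)) * ∑ j, x₀ j
  set y : ℝ → Fin N → ℝ := fun s i => x i s - c
  have hLy : ∀ s, G.lapMatrix ℝ *ᵥ y s = G.lapMatrix ℝ *ᵥ fun j => x j s := by
    intro s
    ext i
    simp [lapMatrix_mulVec_eq_sum_sub, y]
  set f : ℝ → Fin N → ℝ := fun s i => u i s + (G.lapMatrix ℝ *ᵥ fun j => x j s) i
  have hMnorm : ∀ s ≤ T, ∀ v : Fin N → ℝ, ∀ b, ‖v‖ ≤ b →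
      ‖M s *ᵥ v‖ ≤ Γ * Real.exp (-(γ * (T - s))) * b := by
    intro s hs v b hb
    open scoped Matrix.Norms.Operator in
    exact (Matrix.linfty_opNorm_mulVec _ _).trans (mul_le_mul
      (norm_disagreementSemigroup_le G hN hG hγ hγ' (sub_nonneg.2 hs)) hb (norm_nonneg _)
      (by positivity))
  have hcont : ContinuousOn (fun s => M s *ᵥ y s) (Icc 0 T) := by
    refine continuousOn_pi.2 fun i => ?_
    change ContinuousOn (fun s => ∑ j, M s i j * y s j) (Icc 0 T)
    refine continuousOn_finsetSum _ fun j _ => ?_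
    exact ContinuousOn.mul (fun s _ => (hasDerivAt_disagreementSemigroup_apply G T s i
      j).continuousAt.continuousWithinAt) ((h.continuousOn_state hpos hle' j hT).sub
      continuousOn_const)
  have hderiv : ∀ s ∈ Ico 0 T,
      HasDerivWithinAt (fun s => M s *ᵥ y s) (M s *ᵥ f s) (Ici s) s := by
    intro s hs
    have hf : M s *ᵥ f s = (M s * G.lapMatrix ℝ) *ᵥ y s + M s *ᵥ fun j => u j s := by
      rw [← Matrix.mulVec_mulVec, hLy, ← Matrix.mulVec_add]
      congr 1
      ext i
      exact add_comm _ _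
    rw [hf]
    refine hasDerivWithinAt_pi.2 fun i => ?_
    simp only [Pi.add_apply, Matrix.mulVec, dotProduct, ← Finset.sum_add_distrib]
    exact HasDerivWithinAt.fun_sum fun j _ =>
      (hasDerivAt_disagreementSemigroup_apply G T s i j).hasDerivWithinAt.mul
        ((h.hasDerivWithinAt_state hpos hle' j hs.1).sub_const c)
  -- Chosen so that `B 0` is the bound on the initial norm and `B' = (γ - ω) B` is exactly the bound
  -- on `‖M s *ᵥ f s‖`.
  set B : ℝ → ℝ := fun s => Γ * E₀ * Real.exp (-(γ * T)) * Real.exp ((γ - ω) * s)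
  have hB : ∀ s, HasDerivAt B ((γ - ω) * B s) s := by
    intro s
    have h1 := (((hasDerivAt_id s).const_mul (γ - ω)).exp).const_mul
      (Γ * E₀ * Real.exp (-(γ * T)))
    convert! h1 using 1
    simp only [B, id, mul_one]
    ring
  have hinit : ‖M 0 *ᵥ y 0‖ ≤ B 0 := by
    have hy : ‖y 0‖ ≤ E₀ := by
      refine (pi_norm_le_iff_of_nonneg hE₀.le).2 fun i => ?_
      simp only [y, h.dynamics i 0 le_rfl, intervalIntegral.integral_same, add_zero]
      exact hx₀ i
    refine (hMnorm 0 hT _ _ hy).trans (le_of_eq ?_)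
    simp only [B, sub_zero, mul_zero, Real.exp_zero]
    ring
  have hbound : ∀ s ∈ Ico 0 T, ‖M s *ᵥ f s‖ ≤ (γ - ω) * B s := by
    intro s hs
    have hγω : 0 ≤ γ - ω := by
      refine le_trans ?_ (two_mul_gammaInf_mul_le hΓ hτmax hω' i)
      have := hδ i
      positivity
    have hf : ‖f s‖ ≤ (γ - ω) * (E₀ * Real.exp (-(ω * s))) := by
      refine (pi_norm_le_iff_of_nonneg (by positivity)).2 fun i => ?_
      refine (h.abs_input_add_lapMatrix_mulVec_le hpos hle hω hδ hE hR
        (quantRange_eq_mul_exp γ E₀ ω) hsat hs.1 hs.2 i).trans ?_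
      have h1 := mul_le_mul_of_nonneg_right
        (two_mul_gammaInf_mul_le (R := R) (δ := δ) hΓ hτmax hω' i)
        (mul_pos hE₀ (Real.exp_pos (-(ω * s)))).le
      refine le_trans (le_of_eq ?_) h1
      rw [quantRange]
      ring
    refine (hMnorm s hs.2.le _ _ hf).trans (le_of_eq ?_)
    have h2 : Real.exp (-(γ * (T - s))) * Real.exp (-(ω * s)) =
        Real.exp (-(γ * T)) * Real.exp ((γ - ω) * s) := by
      rw [← Real.exp_add, ← Real.exp_add]
      ring_nf
    simp only [B]
    linear_combination (Γ * (γ - ω) * E₀) * h2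
  have hfinal := image_norm_le_of_norm_deriv_right_le_deriv_boundary hcont hderiv hinit hB hbound
    (right_mem_Icc.2 hT)
  have hBT : B T = Γ * E₀ * Real.exp (-(ω * T)) := by
    simp only [B]
    rw [mul_assoc, ← Real.exp_add]
    ring_nf
  have hi := (norm_le_pi_norm (M T *ᵥ y T) i).trans hfinal
  have hj := (norm_le_pi_norm (M T *ᵥ y T) j).trans hfinal
  -- `M T = 1 - J` subtracts the same average from every coordinate, so it drops out of the
  -- difference of coordinates `i` and `j`.
  simp only [M, sub_self, disagreementSemigroup_zero_mulVec, Real.norm_eq_abs, hBT] at hi hj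
  have hij := (abs_sub _ _).trans (add_le_add hi hj)
  refine le_trans (le_of_eq ?_) (hij.trans (le_of_eq ?_))
  · simp only [y]
    congr 1
    ring
  · rw [quantRange]
    ring

/-- Only finitely many sampling times precede a saturated one, so there is an earliest saturated
time `T`. Every sampling strictly before `T` is unsaturated, and the state bound at `T` then
contradicts saturation there. -/
theorem unsaturated : Unsaturated G (quantRange G γ E₀ ω) x t := by
  have hle' : ∀ i, τmin i ≤ τmax i := fun i => (hle i).trans (min_le_right _ _)
  by_contra hcon
  simp only [Unsaturated, not_forall] at hcon
  obtain ⟨i₁, k₁, hbad⟩ := hcon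
  let S : Set (Fin N × ℕ) := {p | t p.1 p.2 ≤ t i₁ k₁ ∧ ¬ ∀ j, G.Adj p.1 j →
    |x p.1 (t p.1 p.2) - x j (t p.1 p.2)| ≤ quantRange G γ E₀ ω (t p.1 p.2)}
  have hfin : S.Finite := (h.finite_setOf_sampling_le hpos hle' (t i₁ k₁)).subset fun p hp => hp.1
  obtain ⟨⟨i, k⟩, hik, hmin⟩ := exists_min_image S (fun p => t p.1 p.2) hfin
    ⟨(i₁, k₁), le_rfl, by simpa only [not_forall] using hbad⟩
  refine hik.2 fun j _ => h.abs_state_sub_state_le hN hG hγ hγ' hpos hle hτmax hω hω' hδ hR hE₀ hx₀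
    (h.sampling_nonneg hpos hle' i k) (fun l m hlm => ?_) i j
  by_contra hl
  exact absurd (hmin (l, m) ⟨hlm.le.trans hik.1, hl⟩) (not_le.2 hlm)

end IsTrajectory

end

end QuantizedConsensus

theorem mainTheorem1 {N : ℕ} (hN : 2 ≤ N)
    (G : SimpleGraph (Fin N)) [DecidableRel G.Adj] (hG : G.Connected)
    (dBound : ℕ) (hdBound : ∀ i, G.degree i ≤ dBound)
    (R : ℕ) (hR : Odd R)
    (overflow : ℝ → ℝ → ℝ)
    (γ : ℝ) (hγ : 0 < γ) (hγ' : γ ≤ QuantizedConsensus.algebraicConnectivity hN G)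
    (δ τmin τmax : Fin N → ℝ) (ω : ℝ)
    (hτmax : ∀ i, 0 < τmax i)
    (hδ : ∀ i, 0 < δ i)
    (hδR : ∀ i, δ i + (G.degree i : ℝ) / R < γ / (2 * QuantizedConsensus.gammaInf G γ))
    (hτmin : ∀ i, 0 < τmin i)
    (hτmin' : ∀ i, τmin i ≤ min (QuantizedConsensus.tauTildeMin G ω δ τmax i) (τmax i))
    (hω : 0 < ω) (hω' : ω ≤ QuantizedConsensus.omegaTilde G γ R δ τmax) :
    (∀ (E₀ : ℝ), 0 < E₀ → ∀ x₀ : Fin N → ℝ, QuantizedConsensus.InitialBound x₀ E₀ →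
      ∀ (x u : Fin N → ℝ → ℝ) (t : Fin N → ℕ → ℝ),
        QuantizedConsensus.IsTrajectory G R overflow (QuantizedConsensus.quantRange G γ E₀ ω)
            δ τmin τmax x₀ x u t →
          QuantizedConsensus.Unsaturated G (QuantizedConsensus.quantRange G γ E₀ ω) x t ∧
          ∀ s, 0 ≤ s → ∀ i j,
            |x i s - x j s| ≤ 2 * QuantizedConsensus.gammaInf G γ * E₀ * Real.exp (-(ω * s))) ∧
    QuantizedConsensus.AchievesConsensus G R overflow γ ω δ τmin τmax := by
  have hΓ := QuantizedConsensus.gammaInf_pos G hN hG hγ hγ'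
  have main : ∀ (E₀ : ℝ), 0 < E₀ → ∀ x₀ : Fin N → ℝ, QuantizedConsensus.InitialBound x₀ E₀ →
      ∀ (x u : Fin N → ℝ → ℝ) (t : Fin N → ℕ → ℝ),
        QuantizedConsensus.IsTrajectory G R overflow (QuantizedConsensus.quantRange G γ E₀ ω)
            δ τmin τmax x₀ x u t →
          QuantizedConsensus.Unsaturated G (QuantizedConsensus.quantRange G γ E₀ ω) x t ∧
          ∀ s, 0 ≤ s → ∀ i j,
            |x i s - x j s| ≤ 2 * QuantizedConsensus.gammaInf G γ * E₀ * Real.exp (-(ω * s)) := by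
    intro E₀ hE₀ x₀ hx₀ x u t h
    have hsat := h.unsaturated hN hG hγ hγ' hτmin hτmin' hτmax hω hω' hδ hR hE₀ hx₀
    exact ⟨hsat, fun s hs => h.abs_state_sub_state_le hN hG hγ hγ' hτmin hτmin' hτmax hω hω' hδ hR
      hE₀ hx₀ hs fun i k _ => hsat i k⟩
  exact ⟨main, 2 * QuantizedConsensus.gammaInf G γ, by positivity,
    fun E₀ hE₀ x₀ hx₀ x u t h => (main E₀ hE₀ x₀ hx₀ x u t h).2⟩
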